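/- All systems are finite-dimensional. Write $\Phi=|\Phi\rangle\langle\Phi|$ with $|\Phi\rangle=\tfrac1{\sqrt2}(|00\rangle+|11\rangle)$ for an ebit. Let $m,l\ge 0$ and $n=m+l$. A purity test protocol with error $\epsilon$ is a trace-preserving completely positive map $\mathcal T$, implementable by (finitely many rounds of) local operations and classical communication, from $2n$ qubits, half held by Alice and half by Bob, to $m$ qubits of Alice, $m$ qubits of Bob and a verdict qubit $V$ with basis states $\mathrm{ACC},\mathrm{REJ}$, such that $$\mathcal T(\Phi^{\otimes n})=\Phi^{\otimes m}\otimes \mathrm{ACC},\qquad \operatorname{Tr}\big[\mathcal T(\rho)\,\big((I-\Phi^{\otimes m})\otimes \mathrm{ACC}\big)\big]<\epsilon\quad\text{for every state }\rho .$$ Let $\mathrm{ERR}_{AB}$ be a fixed state of output registers $A,B$, each of which holds $m$ qubits or an error symbol (for instance the maximally mixed state on $A$ tensored with the error symbol on $B$, or error symbols on both). The protocol $\mathrm{EBIT[PTP]}$: Alice prepares $\Phi^{\otimes n}$ and sends one half of each pair to Bob through an insecure quantum channel; Alice and Bob apply $\mathcal T$; the verdict $V$ is measured in the basis $\mathrm{ACC},\mathrm{REJ}$;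 on $\mathrm{ACC}$ the $2m$ qubits are output in $AB$, and on $\mathrm{REJ}$ the registers $AB$ are output in the state $\mathrm{ERR}_{AB}$; $V$ is also output. The ideal functionality $\mathrm{EBIT_I}$ takes a verdict as input (measured in the basis $\mathrm{ACC},\mathrm{REJ}$) and outputs $\Phi^{\otimes m}\otimes\mathrm{ACC}$ on $\mathrm{ACC}$ and $\mathrm{ERR}_{AB}\otimes\mathrm{REJ}$ on $\mathrm{REJ}$. An environment, which includes the adversary, applies an arbitrary quantum channel to the transmitted system, returning a system of the same kind to the insecure channel and keeping an arbitrary system $E$; it then receives the outputs $A,B,V$ and makes an arbitrary joint measurement of $ABVE$ with a binary outcome $\Gamma$. A simulator plays the role of the honest parties on the insecure channel and supplies the input of $\mathrm{EBIT_I}$; the environment's outcome is then denoted $\Gamma_{\mathrm I}$. A protocol is said to $\delta$-securely realize an ideal functionality if there is a simulator such that $\|\Gamma-\Gamma_{\mathrm I}\|_1\le\delta$ for all environments. **Statement.** For every purity test protocol with error $\epsilon$, the simulator that runs a dummy execution of $\mathrm{EBIT[PTP]}$ with the environment, discards the dummy registers $AB$ and forwards the dummy verdict to $\mathrm{EBIT_I}$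 satisfies $$\|\Gamma-\Gamma_{\mathrm I}\|_1\le 2\sqrt2\,\epsilon^{1/3}$$ for every environment. In particular, $\mathrm{EBIT[PTP]}$ $(2\sqrt2\,\epsilon^{1/3})$-securely realizes $\mathrm{EBIT_I}$. -/

import Mathlib

open Matrix
open scoped Kronecker BigOperators ComplexOrder

noncomputable section

/-! ### Finite-dimensional quantum systems, states and channels

A system is a finite type `A` of basis labels, with Hilbert space `ℂ^A`; the composite of `A` and
`B` is `A × B`. Operators on `A` are matrices `Op A`, and superoperators are linear maps. -/

/-- Operators on the system with basis `A`. -/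
abbrev Op (A : Type) : Type := Matrix A A ℂ

/-- Superoperators from `A` to `B`. -/
abbrev SuperOp (A B : Type) : Type := Op A →ₗ[ℂ] Op B

/-- A density matrix: positive semidefinite of unit trace. -/
structure IsDensity {A : Type} [Fintype A] (ρ : Op A) : Prop where
  pos : ρ.PosSemidef
  trace_one : ρ.trace = 1

/-- `Λ ⊗ id_R`. -/
def SuperOp.onLeft {A B : Type} (Λ : SuperOp A B) (R : Type) : SuperOp (A × R) (B × R) where
  toFun X := Matrix.of fun p q => Λ (Matrix.of fun a a' => X (a, p.2) (a', q.2)) p.1 q.1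
  map_add' X Y := by
    ext p q
    exact congrFun (congrFun (Λ.map_add (Matrix.of fun a a' => X (a, p.2) (a', q.2))
      (Matrix.of fun a a' => Y (a, p.2) (a', q.2))) p.1) q.1
  map_smul' c X := by
    ext p q
    exact congrFun (congrFun (Λ.map_smul c (Matrix.of fun a a' => X (a, p.2) (a', q.2))) p.1) q.1

/-- `id_R ⊗ Λ`. -/
def SuperOp.onRight {A B : Type} (Λ : SuperOp A B) (R : Type) : SuperOp (R × A) (R × B) where
  toFun X := Matrix.of fun p q => Λ (Matrix.of fun a a' => X (p.1, a) (q.1, a')) p.2 q.2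
  map_add' X Y := by
    ext p q
    exact congrFun (congrFun (Λ.map_add (Matrix.of fun a a' => X (p.1, a) (q.1, a'))
      (Matrix.of fun a a' => Y (p.1, a) (q.1, a'))) p.2) q.2
  map_smul' c X := by
    ext p q
    exact congrFun (congrFun (Λ.map_smul c (Matrix.of fun a a' => X (p.1, a) (q.1, a'))) p.2) q.2

/-- Complete positivity: `Λ ⊗ id_R` preserves positive semidefiniteness for every finite `R`. -/
def SuperOp.IsCP {A B : Type} (Λ : SuperOp A B) : Prop :=
  ∀ (R : Type) [Fintype R] [DecidableEq R] (X : Op (A × R)),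
    X.PosSemidef → (Λ.onLeft R X).PosSemidef

/-- A quantum channel: a trace-preserving completely positive linear map. -/
structure QChannel (A B : Type) [Fintype A] [Fintype B] where
  map : SuperOp A B
  cp : map.IsCP
  tp : ∀ X, (map X).trace = X.trace

/-! ### Local operations and classical communication -/

/-- A quantum instrument with classical outcomes in `K`: completely positive maps whose sum is
trace preserving. -/
structure IsInstrument {A B K : Type} [Fintype A] [Fintype B] [Fintype K]
    (M : K → SuperOp A B) : Prop where
  cp : ∀ k, (M k).IsCP
  tp : ∀ X, ∑ k, (M k X).trace = X.trace

/-- Superoperators on a bipartite system (the left factor with Alice, the right one with Bob)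
implemented by finitely many rounds of local operations and classical communication. In each round
one party applies an instrument to its own system and announces the outcome, and the rest of the
protocol may depend on this outcome. -/
inductive IsLOCC : ∀ {A B A' B' : Type}, SuperOp (A × B) (A' × B') → Prop
  | done {A B : Type} : IsLOCC (LinearMap.id : SuperOp (A × B) (A × B))
  | alice {A B A₁ A' B' K : Type} [Fintype A] [Fintype A₁] [Fintype K]
      (M : K → SuperOp A A₁) (hM : IsInstrument M)
      (N : K → SuperOp (A₁ × B) (A' × B')) (hN : ∀ k, IsLOCC (N k)) :
      IsLOCC (∑ k, (N k).comp ((M k).onLeft B))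
  | bob {A B B₁ A' B' K : Type} [Fintype B] [Fintype B₁] [Fintype K]
      (M : K → SuperOp B B₁) (hM : IsInstrument M)
      (N : K → SuperOp (A × B₁) (A' × B')) (hN : ∀ k, IsLOCC (N k)) :
      IsLOCC (∑ k, (N k).comp ((M k).onRight A))

/-! ### Ebits and purity test protocols -/

/-- The basis of `m` qubits. -/
abbrev Qubits (m : ℕ) : Type := Fin m → Fin 2

/-- The verdict register `V`: the basis state `true` is `ACC` and `false` is `REJ`. -/
abbrev Verdict : Type := Bool

/-- The density matrix of one ebit `(|00⟩ + |11⟩) / √2`. -/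
def ebit : Op (Fin 2 × Fin 2) :=
  Matrix.of fun p q => if p.1 = p.2 ∧ q.1 = q.2 then 1 / 2 else 0

/-- `m` ebits `Φ^{⊗ m}`, the left halves grouped together with Alice and the right halves
with Bob. -/
def ebits (m : ℕ) : Op (Qubits m × Qubits m) :=
  Matrix.of fun p q => ∏ i, ebit (p.1 i, p.2 i) (q.1 i, q.2 i)

/-- `X ⊗ |v⟩⟨v|` on the output of a test: Alice's `m` qubits, and Bob's `m` qubits with the
verdict register. -/
def withVerdict {m : ℕ} (X : Op (Qubits m × Qubits m)) (v : Verdict) :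
    Op (Qubits m × (Qubits m × Verdict)) :=
  Matrix.of fun p q =>
    if p.2.2 = v ∧ q.2.2 = v then X (p.1, p.2.1) (q.1, q.2.1) else 0

/-- A purity test protocol with error `ε`: an LOCC channel from `2 (m + l)` qubits, half of them
with Alice and half with Bob, to `2 m` qubits and a verdict, that is complete and sound. -/
structure IsPurityTest (m l : ℕ) (ε : ℝ)
    (T : QChannel (Qubits (m + l) × Qubits (m + l)) (Qubits m × (Qubits m × Verdict))) : Prop where
  locc : IsLOCC T.map
  complete : T.map (ebits (m + l)) = withVerdict (ebits m) true
  sound : ∀ ρ : Op (Qubits (m + l) × Qubits (m + l)), IsDensity ρ →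
    (T.map ρ * withVerdict (1 - ebits m) true).trace.re < ε

/-! ### Protocols using an insecure quantum channel, and their environments -/

/-- A protocol (without input) that uses an insecure quantum channel `C` once. A state of the
honest memory `Mem` and the channel system is prepared, the channel system is sent and received
(possibly altered), and an operation on memory and received system produces the output. -/
structure ChannelProtocol (C Out : Type) [Fintype C] [Fintype Out] where
  Mem : Type
  [fintypeMem : Fintype Mem]
  [decEqMem : DecidableEq Mem]
  init : Op (Mem × C)
  init_density : IsDensity init
  final : QChannel (Mem × C) Out

attribute [instance] ChannelProtocol.fintypeMem ChannelProtocol.decEqMem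

/-- An environment, including the adversary. It applies to the transmitted system an arbitrary
channel `attack`, which returns a system to the channel and keeps a system `E` (private ancillas of
any initial state are part of `attack`). It then receives the output of the protocol and makes an
arbitrary joint measurement of the output and `E`, with a binary outcome `Γ`. -/
structure Environment (C Out : Type) [Fintype C] [Fintype Out] [DecidableEq Out] where
  E : Type
  [fintypeE : Fintype E]
  [decEqE : DecidableEq E]
  attack : QChannel C (C × E)
  povm : Bool → Op (Out × E)
  povm_pos : ∀ b, (povm b).PosSemidef
  povm_sum : ∑ b, povm b = 1

attribute [instance] Environment.fintypeE Environment.decEqE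

section Execution

variable {C Out : Type} [Fintype C] [Fintype Out] [DecidableEq Out]

/-- The joint state of the output and of the environment's system `E` after the execution. -/
def finalState (P : ChannelProtocol C Out) (Z : Environment C Out) : Op (Out × Z.E) :=
  P.final.map.onLeft Z.E
    ((Z.attack.map.onRight P.Mem P.init).submatrix
      (Equiv.prodAssoc P.Mem C Z.E) (Equiv.prodAssoc P.Mem C Z.E))

/-- The distribution of the environment's output bit `Γ`. -/
def outputDist (P : ChannelProtocol C Out) (Z : Environment C Out) (b : Bool) : ℝ :=
  (Z.povm b * finalState P Z).trace.re

/-- The statistical difference `‖Γ - Γ'‖₁` for two protocols with the same environment. -/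
def advantage (P P' : ChannelProtocol C Out) (Z : Environment C Out) : ℝ :=
  ∑ b, |outputDist P Z b - outputDist P' Z b|

end Execution

/-! ### Basic channels -/

theorem SuperOp.IsCP.comp {A B C : Type} [Fintype A] [Fintype B] [Fintype C] {Λ : SuperOp B C}
    {Λ' : SuperOp A B}
    (h : Λ.IsCP) (h' : Λ'.IsCP) : SuperOp.IsCP (Λ.comp Λ') := by
  intro R _ _ X hX
  exact h R _ (h' R X hX)

theorem SuperOp.IsCP.add {A B : Type} {Λ Λ' : SuperOp A B}
    (h : Λ.IsCP) (h' : Λ'.IsCP) : SuperOp.IsCP (Λ + Λ') := by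
  intro R _ _ X hX
  exact (h R X hX).add (h' R X hX)

theorem SuperOp.IsCP.sum {A B K : Type} (s : Finset K) {Λ : K → SuperOp A B}
    (h : ∀ k, (Λ k).IsCP) : SuperOp.IsCP (∑ k ∈ s, Λ k) := by
  classical
  induction s using Finset.induction_on with
  | empty =>
    intro R _ _ X _
    have h0 : SuperOp.onLeft (∑ k ∈ (∅ : Finset K), Λ k) R X = 0 := by
      ext p q
      simp [SuperOp.onLeft]
    rw [h0]
    exact Matrix.PosSemidef.zero
  | insert k s hk ih =>
    rw [Finset.sum_insert hk]
    exact (h k).add ih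

/-- Sequential composition of channels. -/
def QChannel.comp {A B C : Type} [Fintype A] [Fintype B] [Fintype C] (Λ : QChannel B C)
    (Λ' : QChannel A B) : QChannel A C where
  map := Λ.map.comp Λ'.map
  cp := Λ.cp.comp Λ'.cp
  tp X := by simp [Λ.tp, Λ'.tp]

theorem isCP_of_eq_conj {A B : Type} [Fintype A] [DecidableEq A] [Fintype B] {Λ : SuperOp A B}
    (K : Matrix B A ℂ) (h : ∀ X, Λ X = K * X * Kᴴ) : Λ.IsCP := by
  intro R _ _ X hX
  have e : Λ.onLeft R X = (K ⊗ₖ (1 : Op R)) * X * (K ⊗ₖ (1 : Op R))ᴴ := by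
    ext p q
    simp [SuperOp.onLeft, h, Matrix.mul_apply, Fintype.sum_prod_type, Matrix.one_apply,
      Matrix.kroneckerMap_apply, apply_ite (starRingEnd ℂ)]
  rw [e]
  exact hX.mul_mul_conjTranspose_same _

/-- `X ↦ ⟨a|X|a⟩ σ`: if the outcome of a measurement in the computational basis is `a`,
prepare `σ`. -/
def ifPrepare {A B : Type} (a : A) (σ : Op B) : SuperOp A B where
  toFun X := X a a • σ
  map_add' X Y := by simp [add_smul]
  map_smul' c X := by simp [mul_smul]

theorem ifPrepare_isCP {A B : Type} [Fintype A] [Fintype B] [DecidableEq B] (a : A) {σ : Op B}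
    (hσ : σ.PosSemidef) : (ifPrepare a σ).IsCP := by
  intro R _ _ X hX
  have h := hσ.kronecker (hX.submatrix fun r : R => (a, r))
  have e : (ifPrepare a σ).onLeft R X = σ ⊗ₖ X.submatrix (fun r : R => (a, r)) fun r => (a, r) := by
    ext p q
    simp [SuperOp.onLeft, ifPrepare, Matrix.kroneckerMap_apply, mul_comm]
  rw [e]
  exact h

/-- Measure in the computational basis and prepare `σ a` on outcome `a`. -/
def measurePrepare {A B : Type} [Fintype A] [Fintype B] [DecidableEq B] (σ : A → Op B)
    (hσ : ∀ a, IsDensity (σ a)) : QChannel A B where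
  map := ∑ a, ifPrepare a (σ a)
  cp := SuperOp.IsCP.sum _ fun a => ifPrepare_isCP a (hσ a).pos
  tp X := by
    simp [LinearMap.sum_apply, ifPrepare, Matrix.trace_sum, Matrix.trace_smul, (hσ _).trace_one]
    simp [Matrix.trace]

/-- Discarding the first of two systems. -/
def discardLeft (A B : Type) [Fintype A] [Fintype B] : QChannel (A × B) B where
  map :=
    { toFun := fun X => ∑ a, X.submatrix (fun b => (a, b)) fun b => (a, b)
      map_add' := by
        intro X Y
        ext b b'
        simp [Matrix.sum_apply, Finset.sum_add_distrib]
      map_smul' := by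
        intro c X
        ext b b'
        simp [Matrix.sum_apply, Finset.mul_sum] }
  cp := by
    intro R _ _ X hX
    have h : (∑ a : A, X.submatrix (fun p : B × R => ((a, p.1), p.2))
        fun p : B × R => ((a, p.1), p.2)).PosSemidef :=
      Matrix.posSemidef_sum _ fun a _ => hX.submatrix _
    convert h using 1
    ext p q
    simp [SuperOp.onLeft, Matrix.sum_apply]
  tp X := by
    simp only [Matrix.trace, Matrix.diag, LinearMap.coe_mk, AddHom.coe_mk, Matrix.sum_apply,
      Matrix.submatrix_apply, Fintype.sum_prod_type]
    exact Finset.sum_comm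

/-! ### Entanglement generation -/

/-- An output register of `m` qubits or an error symbol `none`. -/
abbrev EbitReg (m : ℕ) : Type := Option (Qubits m)

/-- The output of entanglement generation: Alice's register, Bob's register, and the verdict. -/
abbrev EbitOut (m : ℕ) : Type := (EbitReg m × EbitReg m) × Verdict

/-- An operator on `2 m` qubits as an operator on the output registers, zero on error symbols. -/
def embedOutput {m : ℕ} (X : Op (Qubits m × Qubits m)) : Op (EbitReg m × EbitReg m) :=
  Matrix.of fun p q =>
    match p, q with
    | (some a, some b), (some a', some b') => X (a, b) (a', b')
    | _, _ => 0

/-- `X ⊗ |v⟩⟨v|` on the output registers and the verdict. -/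
def tagged {m : ℕ} (X : Op (EbitReg m × EbitReg m)) (v : Verdict) : Op (EbitOut m) :=
  X ⊗ₖ Matrix.single v v 1

theorem embedOutput_eq_conj {m : ℕ} : ∃ J : Matrix (EbitReg m × EbitReg m) (Qubits m × Qubits m) ℂ,
    ∀ X : Op (Qubits m × Qubits m), embedOutput X = J * X * Jᴴ := by
  refine ⟨Matrix.of fun p x => if p = (some x.1, some x.2) then 1 else 0, fun X => ?_⟩
  ext p q
  obtain ⟨_ | a, _ | b⟩ := p <;> obtain ⟨_ | a', _ | b'⟩ := q <;>
    simp [embedOutput, Matrix.mul_apply, Fintype.sum_prod_type, ite_and,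
      apply_ite (starRingEnd ℂ)]

theorem tagged_eq_conj {m : ℕ} (v : Verdict) :
    ∃ J : Matrix (EbitOut m) (EbitReg m × EbitReg m) ℂ,
      ∀ X : Op (EbitReg m × EbitReg m), tagged X v = J * X * Jᴴ := by
  refine ⟨Matrix.of fun p x => if x = p.1 ∧ p.2 = v then 1 else 0, fun X => ?_⟩
  ext ⟨p, w⟩ ⟨q, w'⟩
  cases v <;> cases w <;> cases w' <;>
    simp [tagged, Matrix.mul_apply, apply_ite (starRingEnd ℂ)]

theorem submatrix_eq_conj {A B : Type} [Fintype A] [DecidableEq A] (f : B → A) (X : Op A) :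
    X.submatrix f f = (1 : Op A).submatrix f id * X * ((1 : Op A).submatrix f id)ᴴ := by
  ext p q
  simp [Matrix.mul_apply, Matrix.one_apply]

theorem embedOutput_posSemidef {m : ℕ} {X : Op (Qubits m × Qubits m)} (hX : X.PosSemidef) :
    (embedOutput X).PosSemidef := by
  obtain ⟨J, hJ⟩ := embedOutput_eq_conj (m := m)
  rw [hJ]
  exact hX.mul_mul_conjTranspose_same J

theorem trace_embedOutput {m : ℕ} (X : Op (Qubits m × Qubits m)) :
    (embedOutput X).trace = X.trace := by
  simp [Matrix.trace, embedOutput, Fintype.sum_prod_type, Fintype.sum_option]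

theorem embedOutput_add {m : ℕ} (X Y : Op (Qubits m × Qubits m)) :
    embedOutput (X + Y) = embedOutput X + embedOutput Y := by
  ext p q
  obtain ⟨_ | a, _ | b⟩ := p <;> obtain ⟨_ | a', _ | b'⟩ := q <;> simp [embedOutput]

theorem embedOutput_smul {m : ℕ} (c : ℂ) (X : Op (Qubits m × Qubits m)) :
    embedOutput (c • X) = c • embedOutput X := by
  ext p q
  obtain ⟨_ | a, _ | b⟩ := p <;> obtain ⟨_ | a', _ | b'⟩ := q <;> simp [embedOutput]

theorem IsDensity.tagged {m : ℕ} {X : Op (EbitReg m × EbitReg m)} (hX : IsDensity X)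
    (v : Verdict) : IsDensity (tagged X v) := by
  have e : (Matrix.single v v 1 : Op Verdict) = Matrix.diagonal (Pi.single v 1) := by
    simp [Matrix.diagonal_single]
  refine ⟨?_, by simp [_root_.tagged, Matrix.trace_kronecker, hX.trace_one]⟩
  refine hX.pos.kronecker ?_
  rw [e]
  refine Matrix.PosSemidef.diagonal fun w => ?_
  by_cases h : w = v
  · subst h; simp
  · simp [h]

theorem ebits_isDensity (m : ℕ) : IsDensity (ebits m) := by
  constructor
  · let v : Qubits m × Qubits m → ℂ :=
      fun p => ∏ i, if p.1 i = p.2 i then ((Real.sqrt (1 / 2) : ℝ) : ℂ) else 0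
    have e : ebits m = Matrix.vecMulVec v (star v) := by
      have hs : ((Real.sqrt (1 / 2) : ℝ) : ℂ) * ((Real.sqrt (1 / 2) : ℝ) : ℂ) = 1 / 2 := by
        rw [← Complex.ofReal_mul, Real.mul_self_sqrt (by norm_num)]
        norm_num
      ext p q
      simp only [ebits, ebit, Matrix.of_apply, Matrix.vecMulVec_apply, v, Pi.star_apply, star_prod,
        ← Finset.prod_mul_distrib]
      refine Finset.prod_congr rfl fun i _ => ?_
      by_cases h1 : p.1 i = p.2 i <;> by_cases h2 : q.1 i = q.2 i <;> simp [h1, h2, -Real.sqrt_inv]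
      simpa using hs.symm
    rw [e]
    exact Matrix.posSemidef_vecMulVec_self_star v
  · have h1 : ∀ a : Qubits m, ∑ b : Qubits m, ∏ i, ebit (a i, b i) (a i, b i)
        = ∏ i, ∑ y, ebit (a i, y) (a i, y) := fun a => by
      rw [Finset.prod_univ_sum, Fintype.piFinset_univ]
    simp only [Matrix.trace, Matrix.diag, ebits, Matrix.of_apply, Fintype.sum_prod_type, h1]
    have h2 : ∀ x : Fin 2, ∑ y, ebit (x, y) (x, y) = 1 / 2 := fun x => by simp [ebit]
    simp [h2]

theorem ebits_embed_isDensity (m : ℕ) : IsDensity (embedOutput (ebits m)) :=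
  ⟨embedOutput_posSemidef (ebits_isDensity m).pos,
    (trace_embedOutput _).trans (ebits_isDensity m).trace_one⟩

/-- The accepted branch of the output of a test: project the verdict register onto `ACC` and move
the `2 m` qubits into the output registers. -/
def acceptBranch (m : ℕ) : SuperOp (Qubits m × (Qubits m × Verdict)) (EbitOut m) where
  toFun X := tagged (embedOutput (Matrix.of fun p q =>
    X (p.1, (p.2, true)) (q.1, (q.2, true)))) true
  map_add' X Y := by
    rw [tagged, tagged, tagged, ← Matrix.add_kronecker, ← embedOutput_add]
    rfl
  map_smul' c X := by
    rw [tagged, tagged, ← Matrix.smul_kronecker, ← embedOutput_smul]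
    rfl

theorem acceptBranch_isCP (m : ℕ) : (acceptBranch m).IsCP := by
  obtain ⟨J, hJ⟩ := embedOutput_eq_conj (m := m)
  obtain ⟨J', hJ'⟩ := tagged_eq_conj (m := m) true
  let f : Qubits m × Qubits m → Qubits m × (Qubits m × Verdict) := fun p => (p.1, (p.2, true))
  refine isCP_of_eq_conj (J' * (J * (1 : Op _).submatrix f id)) fun X => ?_
  have e : acceptBranch m X = tagged (embedOutput (X.submatrix f f)) true := rfl
  rw [e, hJ', hJ, submatrix_eq_conj]
  simp only [Matrix.conjTranspose_mul, Matrix.mul_assoc]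

/-- The filter after a test: the verdict register is measured; on `ACC` the qubits are output
unchanged, and on `REJ` they are discarded and replaced by the error state `err`. -/
def ebitFilter {m : ℕ} (err : Op (EbitReg m × EbitReg m)) (herr : IsDensity err) :
    QChannel (Qubits m × (Qubits m × Verdict)) (EbitOut m) where
  map := acceptBranch m +
    ∑ p : Qubits m × Qubits m, ifPrepare (p.1, (p.2, false)) (tagged err false)
  cp := (acceptBranch_isCP m).add
    (SuperOp.IsCP.sum _ fun _ => ifPrepare_isCP _ (herr.tagged false).pos)
  tp X := by
    have h1 : ∀ Y : Op (EbitReg m × EbitReg m), (tagged Y true).trace = Y.trace := fun Y => by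
      simp [tagged, Matrix.trace_kronecker]
    simp only [LinearMap.add_apply, LinearMap.sum_apply, Matrix.trace_add, Matrix.trace_sum]
    simp [acceptBranch, ifPrepare, h1, trace_embedOutput, Matrix.trace_smul,
      (herr.tagged false).trace_one]
    simp [Matrix.trace, Fintype.sum_prod_type, Finset.sum_add_distrib]

/-- Entanglement generation with a purity test: Alice prepares `m + l` ebits, sends Bob's halves
through the insecure channel, and they apply the test `T` and the filter. -/
def ebitPTP {m l : ℕ}
    (T : QChannel (Qubits (m + l) × Qubits (m + l)) (Qubits m × (Qubits m × Verdict)))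
    (err : Op (EbitReg m × EbitReg m)) (herr : IsDensity err) :
    ChannelProtocol (Qubits (m + l)) (EbitOut m) where
  Mem := Qubits (m + l)
  init := ebits (m + l)
  init_density := ebits_isDensity (m + l)
  final := (ebitFilter err herr).comp T

/-- The ideal functionality: its only input is a verdict, measured in the basis `ACC`, `REJ`.
It outputs `m` perfect ebits on `ACC` and the error state on `REJ`, together with the verdict. -/
def ebitIdeal {m : ℕ} (err : Op (EbitReg m × EbitReg m)) (herr : IsDensity err) :
    QChannel Verdict (EbitOut m) :=
  measurePrepare
    (fun v => if v = true then tagged (embedOutput (ebits m)) true else tagged err false)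
    fun v => by
      split
      · exact (ebits_embed_isDensity m).tagged true
      · exact herr.tagged false

/-- The extended ideal protocol: the simulator `S` takes the place of the honest parties on the
insecure channel, and its output is the input of the ideal functionality. -/
def extendedIdeal {C Ctrl Out : Type} [Fintype C] [Fintype Ctrl] [Fintype Out]
    (F : QChannel Ctrl Out) (S : ChannelProtocol C Ctrl) : ChannelProtocol C Out where
  Mem := S.Mem
  init := S.init
  init_density := S.init_density
  final := F.comp S.final

/-- `P` `δ`-securely realizes the ideal functionality `F`, with a simulator that does not depend on
the environment. -/
def SecurelyRealizes {C Ctrl Out : Type} [Fintype C] [Fintype Ctrl] [Fintype Out]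
    [DecidableEq Out] (P : ChannelProtocol C Out) (F : QChannel Ctrl Out) (δ : ℝ) : Prop :=
  ∃ S : ChannelProtocol C Ctrl, ∀ Z : Environment C Out, advantage P (extendedIdeal F S) Z ≤ δ

/-- The simulator that runs a dummy execution of `P`, discards the dummy registers `O`, and
forwards the dummy verdict. -/
def dummySimulator {C O : Type} [Fintype C] [Fintype O]
    (P : ChannelProtocol C (O × Verdict)) : ChannelProtocol C Verdict where
  Mem := P.Mem
  init := P.init
  init_density := P.init_density
  final := (discardLeft O Verdict).comp P.final

end

/-!
Real and ideal execution differ only in the accepted branch. Let `Y` be the subnormalized joint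
state of the `2 m` accepted qubits and the environment's system `E`. In the real execution this
branch outputs `Y`, in the ideal one it outputs `Φ ⊗ Y_E`, where `Φ` is the state of `m` ebits and
`Y_E` the partial trace; the rejected branches agree because the simulator's verdict has the same
joint state with `E` as the real one (`ebitFilter_sub_ideal`). So the claim is a statement about
`Y - Φ ⊗ Y_E`, and soundness of the test bounds the failure weight `f = tr ((1 - Φ) Y)` by `ε`.

Put `F = Φ ⊗ 1` and `G = 1 - F`. As `Φ` has rank one, `F Y F = Φ ⊗ tr_A (F Y)`, hence
`Φ ⊗ Y_E = F Y F + R` with `R ≥ 0` of trace `f`, and `Y - Φ ⊗ Y_E` is the sum of `G Y G - R`, which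
contributes at most `2 f` to the advantage, and of the cross terms `F Y G + G Y F`. If `W` is
the difference of the two measurement operators, then `-1 ≤ W ≤ 1`, and positivity of
`(t W F - G) Y (t W F - G)ᴴ` bounds the cross terms by `t + f / t` for every `t > 0`
(`re_trace_sub_mul_pinching_le`). This is a gentle measurement bound in which the square root has
been replaced by a free parameter. The choice `t = ε ^ (1 / 3)` gives at most `2 ε + t + t ^ 2`,
which is below `2 √2 t` when `√2 t < 1`; otherwise `2 √2 t ≥ 2` and the bound is trivial.
-/

/-! ### Traces against a two-outcome measurement -/

open scoped MatrixOrder in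
theorem re_trace_mul_nonneg {n : Type} [Fintype n] {P X : Op n}
    (hP : P.PosSemidef) (hX : X.PosSemidef) : 0 ≤ (P * X).trace.re := by
  classical
  obtain ⟨B, rfl⟩ := CStarAlgebra.nonneg_iff_eq_star_mul_self.mp hX.nonneg
  rw [star_eq_conjTranspose, ← Matrix.mul_assoc, Matrix.trace_mul_comm, ← Matrix.mul_assoc]
  exact (Complex.le_def.mp (hP.mul_mul_conjTranspose_same B).trace_nonneg).1

theorem re_trace_sub_mul_le {n : Type} [Fintype n] [DecidableEq n] {P₀ P₁ X : Op n}
    (h₁ : P₁.PosSemidef) (hs : P₀ + P₁ = 1) (hX : X.PosSemidef) :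
    ((P₀ - P₁) * X).trace.re ≤ X.trace.re := by
  have h := re_trace_mul_nonneg h₁ hX
  have e : (P₀ - P₁) * X = X - (P₁ * X + P₁ * X) := by
    rw [eq_sub_of_add_eq hs]; noncomm_ring
  rw [e, Matrix.trace_sub, Matrix.trace_add, Complex.sub_re, Complex.add_re]
  linarith

theorem re_trace_sub_mul_add_nonneg {n : Type} [Fintype n] [DecidableEq n] {P₀ P₁ X : Op n}
    (h₀ : P₀.PosSemidef) (hs : P₀ + P₁ = 1) (hX : X.PosSemidef) :
    0 ≤ ((P₀ - P₁) * X).trace.re + X.trace.re := by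
  have h := re_trace_sub_mul_le (P₀ := P₁) h₀ (by rwa [add_comm]) hX
  rw [← neg_sub P₀ P₁, Matrix.neg_mul, Matrix.trace_neg, Complex.neg_re] at h
  linarith

/-- The operator is `4 P₀ P₁`, which is symmetrized by multiplying with `P₀ + P₁ = 1`. -/
theorem posSemidef_one_sub_sq {n : Type} [Fintype n] [DecidableEq n] {P₀ P₁ : Op n}
    (h₀ : P₀.PosSemidef) (h₁ : P₁.PosSemidef) (hs : P₀ + P₁ = 1) :
    (1 - (P₀ - P₁) * (P₀ - P₁)).PosSemidef := by
  have a := h₀.mul_mul_conjTranspose_same P₁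
  have b := h₁.mul_mul_conjTranspose_same P₀
  rw [h₀.1.eq] at b
  rw [h₁.1.eq] at a
  have e : 1 - (P₀ - P₁) * (P₀ - P₁) =
      (4 : ℕ) • (P₁ * P₀ * P₁ + P₀ * P₁ * P₀) := by
    rw [eq_sub_of_add_eq hs]; noncomm_ring
  rw [e, ← Nat.cast_smul_eq_nsmul ℂ]
  exact (a.add b).smul (by norm_num)

/-- Comparison of `Y` with `F Y F + R`, where `F` is a projection and `R ≥ 0` makes up for the trace
lost in `F Y F`. Up to the choice of `t` this is the gentle measurement lemma. -/
theorem re_trace_sub_mul_pinching_le {n : Type} [Fintype n] [DecidableEq n]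
    {P₀ P₁ F Y R : Op n} (h₀ : P₀.PosSemidef) (h₁ : P₁.PosSemidef) (hs : P₀ + P₁ = 1)
    (hF : F.IsHermitian) (hFF : F * F = F) (hY : Y.PosSemidef) (hR : R.PosSemidef)
    (hRt : R.trace = ((1 - F) * Y).trace) {t : ℝ} (ht : 0 < t) :
    ((P₀ - P₁) * (Y - (F * Y * F + R))).trace.re ≤
      2 * ((1 - F) * Y).trace.re + t * Y.trace.re + ((1 - F) * Y).trace.re / t := by
  obtain ⟨G, hG⟩ : ∃ G, G = 1 - F := ⟨_, rfl⟩
  have hGh : Gᴴ = G := by rw [hG, conjTranspose_sub, conjTranspose_one, hF.eq]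
  have hGG : G * G = G := by rw [hG]; simp [mul_sub, sub_mul, hFF]
  have hFG : F + G = 1 := by rw [hG]; abel
  rw [← hG] at hRt ⊢
  obtain ⟨W, hW⟩ : ∃ W, W = P₀ - P₁ := ⟨_, rfl⟩
  have hWh : Wᴴ = W := by rw [hW, conjTranspose_sub, h₀.1.eq, h₁.1.eq]
  have hGYG : (G * Y * G).trace = (G * Y).trace := by
    rw [Matrix.trace_mul_comm, ← Matrix.mul_assoc, hGG]
  have hFYF : (F * Y * F).trace = (F * Y).trace := by
    rw [Matrix.trace_mul_comm, ← Matrix.mul_assoc, hFF]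
  have hGp : (G * Y * G).PosSemidef := by
    have := hY.mul_mul_conjTranspose_same G
    rwa [hGh] at this
  have hFp : (F * Y * F).PosSemidef := by
    have := hY.mul_mul_conjTranspose_same F
    rwa [hF.eq] at this
  have k1 := re_trace_sub_mul_le h₁ hs hGp
  have k2 := re_trace_sub_mul_add_nonneg h₀ hs hR
  have k3 := re_trace_mul_nonneg (posSemidef_one_sub_sq h₀ h₁ hs) hFp
  have k4 : 0 ≤ (G * Y).trace.re := by
    rw [← hGYG]; exact (Complex.le_def.mp hGp.trace_nonneg).1
  have k5 : (F * Y).trace.re + (G * Y).trace.re = Y.trace.re := by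
    rw [← Complex.add_re, ← Matrix.trace_add, ← add_mul, hFG, one_mul]
  rw [← hW] at k1 k2 k3 ⊢
  -- The two cross terms are adjoint to each other.
  have k6 : (W * (G * Y * F)).trace.re = (W * (F * Y * G)).trace.re := by
    have : (W * (G * Y * F)).trace = star (W * (F * Y * G)).trace := by
      rw [← Matrix.trace_conjTranspose]
      simp only [conjTranspose_mul, hWh, hGh, hF.eq, hY.1.eq]
      rw [Matrix.trace_mul_comm]
      simp only [Matrix.mul_assoc]
    rw [this]; rfl
  -- Completing the square: this positive operator bounds the cross terms by the diagonal ones.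
  have k7 := (Complex.le_def.mp
    (hY.mul_mul_conjTranspose_same ((t : ℂ) • (W * F) - G)).trace_nonneg).1
  have e7 : (((t : ℂ) • (W * F) - G) * Y * ((t : ℂ) • (W * F) - G)ᴴ).trace.re =
      t * (t * ((W * W) * (F * Y * F)).trace.re) - t * (W * (F * Y * G)).trace.re
        - t * (W * (G * Y * F)).trace.re + (G * Y * G).trace.re := by
    have c1 : (W * F * Y * (F * W)).trace = ((W * W) * (F * Y * F)).trace := by
      rw [← Matrix.mul_assoc, Matrix.trace_mul_comm]; simp only [Matrix.mul_assoc]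
    have c2 : (G * Y * (F * W)).trace = (W * (G * Y * F)).trace := by
      rw [← Matrix.mul_assoc, Matrix.trace_mul_comm]
    have c3 : (W * F * Y * G).trace = (W * (F * Y * G)).trace := by
      simp only [Matrix.mul_assoc]
    simp only [conjTranspose_sub, conjTranspose_smul, conjTranspose_mul, hWh, hGh, hF.eq,
      sub_mul, mul_sub, smul_mul_assoc, mul_smul_comm, trace_sub, trace_smul, c1, c2, c3,
      smul_eq_mul, Complex.sub_re, Complex.star_def, Complex.conj_ofReal, Complex.re_ofReal_mul]
    ring
  have e8 : (W * (Y - (F * Y * F + R))).trace.re = (W * (G * Y * G)).trace.re +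
      (W * (F * Y * G)).trace.re + (W * (G * Y * F)).trace.re - (W * R).trace.re := by
    have : Y - (F * Y * F + R) = G * Y * G + F * Y * G + G * Y * F - R := by
      rw [hG]; noncomm_ring
    rw [this]
    simp only [mul_sub, mul_add, trace_sub, trace_add, Complex.sub_re, Complex.add_re]
  have e9 : ((1 - W * W) * (F * Y * F)).trace.re =
      (F * Y * F).trace.re - ((W * W) * (F * Y * F)).trace.re := by
    rw [sub_mul, one_mul, trace_sub, Complex.sub_re]
  rw [e7, hGYG, k6] at k7
  rw [e9, hFYF] at k3
  rw [hRt] at k2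
  rw [hGYG] at k1
  rw [e8, k6]
  simp only [Complex.zero_re] at k7
  have k8 : 2 * (W * (F * Y * G)).trace.re ≤ t * Y.trace.re + (G * Y).trace.re / t := by
    have h1 : t * (W * W * (F * Y * F)).trace.re ≤ t * Y.trace.re :=
      mul_le_mul_of_nonneg_left (by linarith) ht.le
    have h2 : 2 * (W * (F * Y * G)).trace.re - t * (W * W * (F * Y * F)).trace.re ≤
        (G * Y).trace.re / t := by
      rw [le_div_iff₀ ht]; nlinarith
    linarith
  linarith

/-! ### Partial traces and rank-one states -/

theorem discardLeft_apply {A E : Type} [Fintype A] [Fintype E] (X : Op (A × E)) (e e' : E) :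
    (discardLeft A E).map X e e' = ∑ a, X (a, e) (a, e') := by
  simp [discardLeft, Matrix.sum_apply]

theorem discardLeft_posSemidef {A E : Type} [Fintype A] [Fintype E] {X : Op (A × E)}
    (hX : X.PosSemidef) : ((discardLeft A E).map X).PosSemidef :=
  Matrix.posSemidef_sum _ fun _ _ => hX.submatrix _

/-- The partial trace is cyclic for operators that act on the discarded system only. -/
theorem discardLeft_local_mul_comm {A E : Type} [Fintype A] [Fintype E] [DecidableEq E]
    (Q : Op A) (X : Op (A × E)) :
    (discardLeft A E).map ((Q ⊗ₖ (1 : Op E)) * X) =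
      (discardLeft A E).map (X * (Q ⊗ₖ (1 : Op E))) := by
  ext e e'
  simp only [discardLeft_apply, Matrix.mul_apply, Fintype.sum_prod_type, kroneckerMap_apply,
    Matrix.one_apply, mul_ite, ite_mul, mul_one, mul_zero, zero_mul, Finset.sum_ite_eq,
    Finset.sum_ite_eq', Finset.mem_univ, if_true]
  rw [Finset.sum_comm]
  simp only [mul_comm]

/-- The hypothesis `hr` states that `Φ` has rank at most one: all its `2 × 2` minors vanish. -/
theorem conj_rankOne_local {A E : Type} [Fintype A] [Fintype E] [DecidableEq E] {Φ : Op A}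
    (hr : ∀ a b c d, Φ a b * Φ c d = Φ a d * Φ c b) (Y : Op (A × E)) :
    (Φ ⊗ₖ (1 : Op E)) * Y * (Φ ⊗ₖ (1 : Op E)) =
      Φ ⊗ₖ (discardLeft A E).map ((Φ ⊗ₖ (1 : Op E)) * Y) := by
  ext ⟨a, e⟩ ⟨d, e'⟩
  simp only [discardLeft_apply, Matrix.mul_apply, Fintype.sum_prod_type, kroneckerMap_apply,
    Matrix.one_apply, mul_ite, ite_mul, mul_one, mul_zero, zero_mul, Finset.sum_ite_eq,
    Finset.sum_ite_eq', Finset.mem_univ, if_true, Finset.sum_mul, Finset.mul_sum]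
  refine Finset.sum_congr rfl fun c _ => Finset.sum_congr rfl fun b _ => ?_
  rw [mul_right_comm, hr, ← mul_assoc]

theorem rankOne_mul_self {A : Type} [Fintype A] {Φ : Op A}
    (hr : ∀ a b c d, Φ a b * Φ c d = Φ a d * Φ c b) (ht : Φ.trace = 1) : Φ * Φ = Φ := by
  ext a d
  rw [Matrix.mul_apply, Finset.sum_congr rfl fun b _ => hr a b b d, ← Finset.mul_sum]
  change Φ a d * Φ.trace = _
  rw [ht, mul_one]

theorem one_sub_rankOne_posSemidef {A : Type} [Fintype A] [DecidableEq A] {Φ : Op A}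
    (hΦ : IsDensity Φ) (hr : ∀ a b c d, Φ a b * Φ c d = Φ a d * Φ c b) :
    (1 - Φ).PosSemidef := by
  have h := Matrix.posSemidef_conjTranspose_mul_self (1 - Φ)
  rwa [conjTranspose_sub, conjTranspose_one, hΦ.pos.1.eq,
    show (1 - Φ) * (1 - Φ) = 1 - Φ by
      simp [mul_sub, sub_mul, rankOne_mul_self hr hΦ.trace_one]] at h

/-- A state `Y` that nearly passes the projection onto a pure state `Φ` is nearly the product of `Φ`
with its own reduced state. -/
theorem re_trace_sub_mul_rankOne_le {A E : Type} [Fintype A] [Fintype E] [DecidableEq A]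
    [DecidableEq E] {Φ : Op A} (hΦ : IsDensity Φ)
    (hr : ∀ a b c d, Φ a b * Φ c d = Φ a d * Φ c b) {Y P₀ P₁ : Op (A × E)} (hY : Y.PosSemidef)
    (h₀ : P₀.PosSemidef) (h₁ : P₁.PosSemidef) (hs : P₀ + P₁ = 1) {t : ℝ} (ht : 0 < t) :
    ((P₀ - P₁) * (Y - Φ ⊗ₖ (discardLeft A E).map Y)).trace.re ≤
      2 * (((1 - Φ) ⊗ₖ (1 : Op E)) * Y).trace.re + t * Y.trace.re +
        (((1 - Φ) ⊗ₖ (1 : Op E)) * Y).trace.re / t := by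
  have hidem := rankOne_mul_self hr hΦ.trace_one
  have e1 : (1 - Φ) ⊗ₖ (1 : Op E) = 1 - Φ ⊗ₖ (1 : Op E) := by
    rw [eq_sub_iff_add_eq, ← Matrix.add_kronecker, sub_add_cancel, Matrix.one_kronecker_one]
  have hFh : (Φ ⊗ₖ (1 : Op E)).IsHermitian := by
    rw [IsHermitian, conjTranspose_kronecker, hΦ.pos.1.eq, conjTranspose_one]
  have hFF : (Φ ⊗ₖ (1 : Op E)) * (Φ ⊗ₖ (1 : Op E)) = Φ ⊗ₖ (1 : Op E) := by
    rw [← Matrix.mul_kronecker_mul, hidem, mul_one]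
  have hGG : ((1 - Φ) ⊗ₖ (1 : Op E)) * ((1 - Φ) ⊗ₖ (1 : Op E)) = (1 - Φ) ⊗ₖ (1 : Op E) := by
    rw [← Matrix.mul_kronecker_mul, mul_one]
    simp [mul_sub, sub_mul, hidem]
  have hGh : ((1 - Φ) ⊗ₖ (1 : Op E))ᴴ = (1 - Φ) ⊗ₖ (1 : Op E) := by
    rw [e1, conjTranspose_sub, conjTranspose_one, hFh.eq]
  have hR : ((discardLeft A E).map (((1 - Φ) ⊗ₖ (1 : Op E)) * Y)).PosSemidef := by
    have h := discardLeft_posSemidef (hY.mul_mul_conjTranspose_same ((1 - Φ) ⊗ₖ (1 : Op E)))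
    rwa [hGh, Matrix.mul_assoc, discardLeft_local_mul_comm, Matrix.mul_assoc, hGG,
      ← discardLeft_local_mul_comm] at h
  have e2 : Φ ⊗ₖ (discardLeft A E).map Y =
      (Φ ⊗ₖ (1 : Op E)) * Y * (Φ ⊗ₖ (1 : Op E)) +
        Φ ⊗ₖ (discardLeft A E).map (((1 - Φ) ⊗ₖ (1 : Op E)) * Y) := by
    rw [conj_rankOne_local hr, ← Matrix.kronecker_add, ← map_add, ← add_mul, e1,
      add_sub_cancel, one_mul]
  rw [e2, e1]
  refine re_trace_sub_mul_pinching_le h₀ h₁ hs hFh hFF hY (hΦ.pos.kronecker ?_) ?_ ht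
  · rwa [← e1]
  · rw [Matrix.trace_kronecker, hΦ.trace_one, one_mul, (discardLeft A E).tp]

theorem ebits_rankOne (m : ℕ) (a b c d : Qubits m × Qubits m) :
    ebits m a b * ebits m c d = ebits m a d * ebits m c b := by
  simp only [ebits, ebit, Matrix.of_apply, ← Finset.prod_mul_distrib]
  refine Finset.prod_congr rfl fun i _ => ?_
  by_cases h1 : a.1 i = a.2 i <;> by_cases h2 : b.1 i = b.2 i <;>
    by_cases h3 : c.1 i = c.2 i <;> by_cases h4 : d.1 i = d.2 i <;> simp [h1, h2, h3, h4]

/-! ### Density matrices under local channels -/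

theorem QChannel.trace_onLeft {A B R : Type} [Fintype A] [Fintype B] [Fintype R]
    (Λ : QChannel A B) (X : Op (A × R)) : (Λ.map.onLeft R X).trace = X.trace := by
  simp only [Matrix.trace, Matrix.diag, Fintype.sum_prod_type_right]
  exact Finset.sum_congr rfl fun r _ => Λ.tp (Matrix.of fun a a' => X (a, r) (a', r))

theorem trace_submatrix_equiv {A B : Type} [Fintype A] [Fintype B] (e : A ≃ B) (X : Op B) :
    (X.submatrix e e).trace = X.trace :=
  e.sum_comp fun b => X b b

theorem IsDensity.onLeft {A B R : Type} [Fintype A] [Fintype B] [Fintype R] [DecidableEq R]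
    {X : Op (A × R)} (hX : IsDensity X) (Λ : QChannel A B) : IsDensity (Λ.map.onLeft R X) :=
  ⟨Λ.cp R X hX.pos, (Λ.trace_onLeft X).trans hX.trace_one⟩

theorem IsDensity.submatrix_equiv {A B : Type} [Fintype A] [Fintype B] {X : Op B}
    (hX : IsDensity X) (e : A ≃ B) : IsDensity (X.submatrix e e) :=
  ⟨hX.pos.submatrix e, (trace_submatrix_equiv e X).trans hX.trace_one⟩

theorem IsDensity.onRight {A B R : Type} [Fintype A] [Fintype B] [Fintype R] [DecidableEq R]
    {X : Op (R × A)} (hX : IsDensity X) (Λ : QChannel A B) : IsDensity (Λ.map.onRight R X) :=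
  ((hX.submatrix_equiv (Equiv.prodComm A R)).onLeft Λ).submatrix_equiv (Equiv.prodComm R B)

/-- The partial trace over the right factor. -/
noncomputable def partialTraceRight {A E : Type} [Fintype E] (X : Op (A × E)) : Op A :=
  ∑ e, X.submatrix (fun a => (a, e)) fun a => (a, e)

theorem IsDensity.partialTraceRight {A E : Type} [Fintype A] [Fintype E] {X : Op (A × E)}
    (hX : IsDensity X) : IsDensity (partialTraceRight X) := by
  refine ⟨Matrix.posSemidef_sum _ fun _ _ => hX.pos.submatrix _, ?_⟩
  rw [← hX.trace_one]
  simp [_root_.partialTraceRight, Matrix.trace, Fintype.sum_prod_type_right, Matrix.sum_apply]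
  rw [Finset.sum_comm]

theorem partialTraceRight_onLeft {A B E : Type} [Fintype E] (Λ : SuperOp A B) (X : Op (A × E)) :
    partialTraceRight (Λ.onLeft E X) = Λ (partialTraceRight X) := by
  simp only [partialTraceRight, map_sum]
  rfl

/-! ### The accepted part of a test -/

/-- The accepted part of the joint state of a test's output and a further system: the
block in which the verdict is `ACC`. It is not normalized. -/
def acceptedPart {m : ℕ} {E : Type} (σ : Op ((Qubits m × (Qubits m × Verdict)) × E)) :
    Op ((Qubits m × Qubits m) × E) :=
  σ.submatrix (fun p => ((p.1.1, (p.1.2, true)), p.2)) fun p => ((p.1.1, (p.1.2, true)), p.2)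

/-- The left side is a weight in the joint state with `E`, the right side is the quantity that
soundness of the test bounds. -/
theorem trace_mul_acceptedPart {m : ℕ} {E : Type} [Fintype E] [DecidableEq E]
    (Q : Op (Qubits m × Qubits m)) (σ : Op ((Qubits m × (Qubits m × Verdict)) × E)) :
    ((Q ⊗ₖ (1 : Op E)) * acceptedPart σ).trace =
      (partialTraceRight σ * withVerdict Q true).trace := by
  rw [Matrix.trace_mul_comm]
  simp only [Matrix.trace, Matrix.diag, Matrix.mul_apply, Fintype.sum_prod_type, acceptedPart,
    Matrix.submatrix_apply, kroneckerMap_apply, Matrix.one_apply, withVerdict, Matrix.of_apply,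
    partialTraceRight, Matrix.sum_apply, Fintype.univ_bool,
    Finset.sum_pair (by decide : true ≠ false)]
  simp [Finset.sum_mul]
  refine Finset.sum_congr rfl fun a _ => Finset.sum_congr rfl fun b _ => ?_
  rw [Finset.sum_comm]
  refine Finset.sum_congr rfl fun a' _ => ?_
  rw [Finset.sum_comm]

theorem trace_acceptedPart_le {m : ℕ} {E : Type} [Fintype E]
    {σ : Op ((Qubits m × (Qubits m × Verdict)) × E)} (hσ : IsDensity σ) :
    (acceptedPart σ).trace.re ≤ 1 := by
  have h : σ.trace = (acceptedPart σ).trace +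
      (σ.submatrix (fun p : (Qubits m × Qubits m) × E => ((p.1.1, (p.1.2, false)), p.2))
        fun p => ((p.1.1, (p.1.2, false)), p.2)).trace := by
    simp [Matrix.trace, Fintype.sum_prod_type, acceptedPart, Finset.sum_add_distrib]
  rw [hσ.trace_one] at h
  have h2 := (Complex.le_def.mp (hσ.pos.submatrix
    (fun p : (Qubits m × Qubits m) × E => ((p.1.1, (p.1.2, false)), p.2))).trace_nonneg).1
  have h3 := congrArg Complex.re h
  simp only [Complex.add_re, Complex.one_re, Complex.zero_re] at h3 h2
  linarith

/-! ### The filter and the ideal functionality -/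

theorem discardLeft_tagged_apply {m : ℕ} (X : Op (EbitReg m × EbitReg m)) (v w : Verdict) :
    (discardLeft (EbitReg m × EbitReg m) Verdict).map (tagged X v) w w =
      if w = v then X.trace else 0 := by
  rw [discardLeft_apply]
  cases v <;> cases w <;> simp [tagged, Matrix.trace]

theorem ebitFilter_apply {m : ℕ} (err : Op (EbitReg m × EbitReg m)) (herr : IsDensity err)
    (M : Op (Qubits m × (Qubits m × Verdict))) :
    (ebitFilter err herr).map M =
      tagged (embedOutput (Matrix.of fun p q : Qubits m × Qubits m =>
        M (p.1, (p.2, true)) (q.1, (q.2, true)))) true +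
      (∑ p : Qubits m × Qubits m, M (p.1, (p.2, false)) (p.1, (p.2, false))) •
        tagged err false := by
  simp only [ebitFilter, LinearMap.add_apply, LinearMap.sum_apply, Finset.sum_smul]
  rfl

theorem ebitIdeal_apply {m : ℕ} (err : Op (EbitReg m × EbitReg m)) (herr : IsDensity err)
    (X : Op Verdict) :
    (ebitIdeal err herr).map X = X true true • tagged (embedOutput (ebits m)) true +
      X false false • tagged err false := by
  simp [ebitIdeal, measurePrepare, ifPrepare]

/-- The ideal functionality, fed with the verdict of the filter, agrees with the filter except that
it replaces the accepted qubits by fresh ebits of the same weight. -/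
theorem ebitFilter_sub_ideal {m : ℕ} (err : Op (EbitReg m × EbitReg m)) (herr : IsDensity err)
    (M : Op (Qubits m × (Qubits m × Verdict))) :
    (ebitFilter err herr).map M - ((ebitIdeal err herr).map
        ((discardLeft (EbitReg m × EbitReg m) Verdict).map ((ebitFilter err herr).map M))) =
      tagged (embedOutput (Matrix.of fun p q : Qubits m × Qubits m =>
        M (p.1, (p.2, true)) (q.1, (q.2, true)) -
          ebits m p q *
            ∑ r : Qubits m × Qubits m, M (r.1, (r.2, true)) (r.1, (r.2, true)))) true := by
  rw [ebitIdeal_apply, ebitFilter_apply]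
  simp only [map_add, map_smul, Matrix.add_apply, Matrix.smul_apply, discardLeft_tagged_apply,
    herr.trace_one, trace_embedOutput]
  simp only [if_true, Bool.false_eq_true, Bool.true_eq_false, if_false,
    zero_add, smul_eq_mul, mul_one, add_sub_add_right_eq_sub]
  ext ⟨⟨_ | a, _ | b⟩, v⟩ ⟨⟨_ | a', _ | b'⟩, w⟩ <;>
    simp [tagged, embedOutput, Matrix.trace]
  ring

/-- The position of the joint state of `2 m` accepted qubits and `E` inside the joint state of the
output of the protocol and `E`. -/
def acceptIndex {m : ℕ} {E : Type} (p : (Qubits m × Qubits m) × E) : EbitOut m × E :=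
  (((some p.1.1, some p.1.2), true), p.2)

theorem acceptIndex_injective {m : ℕ} {E : Type} :
    Function.Injective (acceptIndex (m := m) (E := E)) := by
  rintro ⟨⟨a, b⟩, e⟩ ⟨⟨a', b'⟩, e'⟩ h
  simpa [acceptIndex, and_assoc] using h

/-! ### Real and ideal execution -/

/-- The joint state of the environment's system, Alice's half of the ebits and the system that
reaches Bob, after the attack. -/
noncomputable def attackedState {m l : ℕ} (Z : Environment (Qubits (m + l)) (EbitOut m)) :
    Op ((Qubits (m + l) × Qubits (m + l)) × Z.E) :=
  (Z.attack.map.onRight (Qubits (m + l)) (ebits (m + l))).submatrix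
    (Equiv.prodAssoc _ _ Z.E) (Equiv.prodAssoc _ _ Z.E)

theorem attackedState_isDensity {m l : ℕ} (Z : Environment (Qubits (m + l)) (EbitOut m)) :
    IsDensity (attackedState Z) :=
  ((ebits_isDensity (m + l)).onRight Z.attack).submatrix_equiv _

theorem finalState_ebitPTP {m l : ℕ}
    (T : QChannel (Qubits (m + l) × Qubits (m + l)) (Qubits m × (Qubits m × Verdict)))
    (err : Op (EbitReg m × EbitReg m)) (herr : IsDensity err)
    (Z : Environment (Qubits (m + l)) (EbitOut m)) :
    finalState (ebitPTP T err herr) Z =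
      (ebitFilter err herr).map.onLeft Z.E (T.map.onLeft Z.E (attackedState Z)) := rfl

theorem finalState_extendedIdeal {m l : ℕ}
    (T : QChannel (Qubits (m + l) × Qubits (m + l)) (Qubits m × (Qubits m × Verdict)))
    (err : Op (EbitReg m × EbitReg m)) (herr : IsDensity err)
    (Z : Environment (Qubits (m + l)) (EbitOut m)) :
    finalState (extendedIdeal (ebitIdeal err herr) (dummySimulator (ebitPTP T err herr))) Z =
      (ebitIdeal err herr).map.onLeft Z.E
        ((discardLeft (EbitReg m × EbitReg m) Verdict).map.onLeft Z.E
          ((ebitFilter err herr).map.onLeft Z.E (T.map.onLeft Z.E (attackedState Z)))) := rfl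

theorem ebitFilter_onLeft_sub_ideal_apply {m : ℕ} {E : Type} [Fintype E]
    (err : Op (EbitReg m × EbitReg m)) (herr : IsDensity err)
    (σ : Op ((Qubits m × (Qubits m × Verdict)) × E)) (p q : EbitOut m × E) :
    ((ebitFilter err herr).map.onLeft E σ - (ebitIdeal err herr).map.onLeft E
        ((discardLeft (EbitReg m × EbitReg m) Verdict).map.onLeft E
          ((ebitFilter err herr).map.onLeft E σ))) p q =
      tagged (embedOutput (Matrix.of fun a b : Qubits m × Qubits m =>
        (acceptedPart σ - ebits m ⊗ₖ (discardLeft _ E).map (acceptedPart σ))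
          (a, p.2) (b, q.2))) true p.1 q.1 := by
  have h := congrFun (congrFun (ebitFilter_sub_ideal err herr
    (Matrix.of fun a a' => σ (a, p.2) (a', q.2))) p.1) q.1
  simp only [Matrix.sub_apply, kroneckerMap_apply, discardLeft_apply]
  exact h

/-- If `X` is `D` placed at the indices in the range of `f` and is zero elsewhere, then only the
corresponding block of `P` matters. -/
theorem trace_mul_eq_of_support {A B : Type} [Fintype A] [Fintype B] {f : A → B}
    (hf : Function.Injective f) (P : Op B) {X : Op B} {D : Op A}
    (hD : ∀ a b, X (f a) (f b) = D a b) (hl : ∀ p q, p ∉ Set.range f → X p q = 0)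
    (hr : ∀ p q, q ∉ Set.range f → X p q = 0) :
    (P * X).trace = (P.submatrix f f * D).trace := by
  simp only [Matrix.trace, Matrix.diag, Matrix.mul_apply]
  refine (Fintype.sum_of_injective f hf _ _ (fun p hp => ?_) fun a => ?_).symm
  · exact Finset.sum_eq_zero fun q _ => by rw [hr q p hp, mul_zero]
  · refine Fintype.sum_of_injective f hf _ _ (fun q hq => ?_) fun b => ?_
    · rw [hl q _ hq, mul_zero]
    · rw [hD]; rfl

theorem trace_mul_eq_of_tagged {m : ℕ} {E : Type} [Fintype E] (P X : Op (EbitOut m × E))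
    (D : Op ((Qubits m × Qubits m) × E))
    (hX : ∀ p q, X p q = tagged (embedOutput (Matrix.of fun a b : Qubits m × Qubits m =>
        D (a, p.2) (b, q.2))) true p.1 q.1) :
    (P * X).trace = (P.submatrix acceptIndex acceptIndex * D).trace := by
  refine trace_mul_eq_of_support acceptIndex_injective P ?_ ?_ ?_
  · rintro ⟨⟨a, b⟩, e⟩ ⟨⟨a', b'⟩, e'⟩
    simp [hX, acceptIndex, tagged, embedOutput]
  · rintro ⟨⟨⟨_ | a, _ | b⟩, _ | _⟩, e⟩ q hp
    all_goals first
      | exact absurd ⟨((_, _), _), rfl⟩ hp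
      | simp [hX, tagged, embedOutput]
  · rintro p ⟨⟨⟨_ | a, _ | b⟩, _ | _⟩, e⟩ hp
    all_goals first
      | exact absurd ⟨((_, _), _), rfl⟩ hp
      | simp [hX, tagged, embedOutput]

theorem advantage_le {m l : ℕ} {ε : ℝ}
    (T : QChannel (Qubits (m + l) × Qubits (m + l)) (Qubits m × (Qubits m × Verdict)))
    (hT : IsPurityTest m l ε T)
    (err : Op (EbitReg m × EbitReg m)) (herr : IsDensity err)
    (Z : Environment (Qubits (m + l)) (EbitOut m)) :
    advantage (ebitPTP T err herr)
        (extendedIdeal (ebitIdeal err herr) (dummySimulator (ebitPTP T err herr))) Z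
        ≤ 2 * Real.sqrt 2 * ε ^ (1 / 3 : ℝ) := by
  have hσ := (attackedState_isDensity Z).onLeft T
  obtain ⟨Y, hYdef⟩ : ∃ Y, Y = acceptedPart (T.map.onLeft Z.E (attackedState Z)) := ⟨_, rfl⟩
  have hY : Y.PosSemidef := hYdef ▸ hσ.pos.submatrix _
  have hY1 : Y.trace.re ≤ 1 := hYdef ▸ trace_acceptedPart_le hσ
  obtain ⟨f, hf⟩ : ∃ f, f = (((1 - ebits m) ⊗ₖ (1 : Op Z.E)) * Y).trace.re := ⟨_, rfl⟩
  have hfε : f < ε := by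
    rw [hf, hYdef, trace_mul_acceptedPart, partialTraceRight_onLeft]
    exact hT.sound _ (attackedState_isDensity Z).partialTraceRight
  let Q : Bool → Op ((Qubits m × Qubits m) × Z.E) := fun b =>
    (Z.povm b).submatrix acceptIndex acceptIndex
  have hQ : ∀ b, (Q b).PosSemidef := fun b => (Z.povm_pos b).submatrix _
  have hQs : Q true + Q false = 1 := by
    have h := congrArg (fun X => X.submatrix (acceptIndex (m := m) (E := Z.E)) acceptIndex)
      Z.povm_sum
    simp only [Fintype.sum_bool, Matrix.submatrix_one _ acceptIndex_injective] at h
    exact h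
  obtain ⟨S, hS⟩ : ∃ S, S = ebits m ⊗ₖ (discardLeft _ Z.E).map Y := ⟨_, rfl⟩
  have hSp : S.PosSemidef := hS ▸ (ebits_isDensity m).pos.kronecker (discardLeft_posSemidef hY)
  have hSt : S.trace = Y.trace := by
    rw [hS, Matrix.trace_kronecker, (ebits_isDensity m).trace_one, one_mul, (discardLeft _ _).tp]
  have hout : ∀ b, outputDist (ebitPTP T err herr) Z b - outputDist (extendedIdeal
      (ebitIdeal err herr) (dummySimulator (ebitPTP T err herr))) Z b =
      (Q b * Y).trace.re - (Q b * S).trace.re := by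
    intro b
    rw [outputDist, outputDist, ← Complex.sub_re, ← Matrix.trace_sub, ← mul_sub,
      finalState_ebitPTP, finalState_extendedIdeal,
      trace_mul_eq_of_tagged _ _ _ (ebitFilter_onLeft_sub_ideal_apply err herr _),
      ← Complex.sub_re, ← Matrix.trace_sub, ← mul_sub, hS, hYdef]
  have hsumY : (Q true * Y).trace.re + (Q false * Y).trace.re = Y.trace.re := by
    rw [← Complex.add_re, ← Matrix.trace_add, ← add_mul, hQs, one_mul]
  have hsumS : (Q true * S).trace.re + (Q false * S).trace.re = Y.trace.re := by
    rw [← Complex.add_re, ← Matrix.trace_add, ← add_mul, hQs, one_mul, hSt]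
  have hQY := fun b => re_trace_mul_nonneg (hQ b) hY
  have hQS := fun b => re_trace_mul_nonneg (hQ b) hSp
  have hf0 : 0 ≤ f := by
    rw [hf]
    exact re_trace_mul_nonneg ((one_sub_rankOne_posSemidef (ebits_isDensity m)
      (ebits_rankOne m)).kronecker Matrix.PosSemidef.one) hY
  have hε : 0 < ε := hf0.trans_lt hfε
  rw [advantage, Fintype.sum_bool, hout, hout]
  obtain ⟨y, hy⟩ : ∃ y, y = ε ^ (1 / 3 : ℝ) := ⟨_, rfl⟩
  have hy0 : 0 < y := hy ▸ Real.rpow_pos_of_pos hε _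
  have hy3 : y ^ 3 = ε := by
    rw [hy, ← Real.rpow_natCast, ← Real.rpow_mul hε.le]; norm_num
  rw [← hy]
  have hs0 : 1.414 < Real.sqrt 2 := Real.lt_sqrt_of_sq_lt (by norm_num)
  -- If `√2 y ≥ 1`, the trivial bound `2` suffices; otherwise the parameter is `t = y`.
  rcases le_or_gt 1 (Real.sqrt 2 * y) with hbig | hsmall
  · have h1 := hQY true
    have h2 := hQY false
    have h3 := hQS true
    have h4 := hQS false
    have : |(Q true * Y).trace.re - (Q true * S).trace.re| ≤ 1 :=
      abs_le.mpr ⟨by linarith, by linarith⟩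
    have : |(Q false * Y).trace.re - (Q false * S).trace.re| ≤ 1 :=
      abs_le.mpr ⟨by linarith, by linarith⟩
    linarith
  · have b1 := re_trace_sub_mul_rankOne_le (ebits_isDensity m) (ebits_rankOne m) hY
      (hQ true) (hQ false) hQs hy0
    have b2 := re_trace_sub_mul_rankOne_le (ebits_isDensity m) (ebits_rankOne m) hY
      (hQ false) (hQ true) ((add_comm _ _).trans hQs) hy0
    rw [← hS, ← hf] at b1 b2
    simp only [sub_mul, mul_sub, Matrix.trace_sub, Complex.sub_re] at b1 b2
    -- The bound is a rational number slightly above `1 / √2`.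
    have hyb : y < 0.70722 := by nlinarith
    have hfy : f / y ≤ y ^ 2 := by
      rw [div_le_iff₀ hy0]; nlinarith
    have hyY : y * Y.trace.re ≤ y := mul_le_of_le_one_right hy0.le hY1
    have hnum : 2 * f + y + y ^ 2 ≤ 2 * Real.sqrt 2 * y := by
      have h1 : y ^ 2 ≤ 0.70722 * y := by nlinarith
      have h2 : y ^ 3 ≤ 0.70722 * (0.70722 * y) := by nlinarith
      nlinarith
    rcases abs_cases ((Q true * Y).trace.re - (Q true * S).trace.re) with ⟨h1, -⟩ | ⟨h1, -⟩ <;>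
    rcases abs_cases ((Q false * Y).trace.re - (Q false * S).trace.re) with ⟨h2, -⟩ | ⟨h2, -⟩ <;>
    rw [h1, h2] <;> linarith

theorem mainTheorem2 (m l : ℕ) (ε : ℝ)
    (T : QChannel (Qubits (m + l) × Qubits (m + l)) (Qubits m × (Qubits m × Verdict)))
    (hT : IsPurityTest m l ε T)
    (err : Op (EbitReg m × EbitReg m)) (herr : IsDensity err) :
    (∀ Z : Environment (Qubits (m + l)) (EbitOut m),
      advantage (ebitPTP T err herr)
        (extendedIdeal (ebitIdeal err herr) (dummySimulator (ebitPTP T err herr))) Z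
        ≤ 2 * Real.sqrt 2 * ε ^ (1 / 3 : ℝ)) ∧
    SecurelyRealizes (ebitPTP T err herr) (ebitIdeal err herr)
      (2 * Real.sqrt 2 * ε ^ (1 / 3 : ℝ)) :=
  ⟨advantage_le T hT err herr, _, advantage_le T hT err herr⟩
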